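/- Let $\mathcal S$ and $\mathcal T$ be triangulated categories with countable direct sums, and let $E\colon\mathcal S\to\mathcal T$ and $F\colon\mathcal T\to\mathcal S$ be exact functors compatible with countable direct sums, with $E$ left adjoint to $F$. Let $\mathcal I=\ker F$, i.e. $\mathcal I(A,B)=\{f\in\mathcal T(A,B): F(f)=0\}$, and let $L=EF$ be the associated comonad on $\mathcal T$, with counit $\epsilon$. An object $P\in\mathcal T$ is called $\mathcal I$-projective if $\mathcal I(P,B)=0$ for all $B\in\mathcal T$, and $\mathcal N_{\mathcal I}$ denotes the full subcategory of the $\mathcal I$-contractible objects $N$, i.e. those with $\mathrm{id}_N\in\mathcal I(N,N)$. (1) For every $A\in\mathcal T$ the comonad bar construction $P_n=L^{n+1}A$ ($n\ge 0$), with boundary maps $\delta_n=\sum_{i=0}^n(-1)^iL^i(\epsilon_{L^{n-i}A})\colon P_n\to P_{n-1}$ for $n\ge1$ and augmentation $\delta_0=\epsilon_A\colon P_0\to A$, is an $\mathcal I$-projective resolution of $A$: every $P_n$ is $\mathcal I$-projective, $\cdots\to P_1\to P_0\to A$ is a chain complex, and the complex $\cdots\to F(P_1)\to F(P_0)\to F(A)\to0$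 is contractible by a chain homotopy in $\mathcal S$. (2) Let $\langle E\mathcal S\rangle$ be the localizing subcategory generated by the objects $EX$, $X\in\mathcal S$, i.e. the smallest strictly full triangulated subcategory of $\mathcal T$ that contains them and is closed under countable direct sums. Then the pair $(\langle E\mathcal S\rangle,\mathcal N_{\mathcal I})$ is complementary: both are triangulated subcategories of $\mathcal T$ closed under direct summands, $\mathcal T(P,N)=0$ for all $P\in\langle E\mathcal S\rangle$ and $N\in\mathcal N_{\mathcal I}$, and every $A\in\mathcal T$ fits into an exact triangle $P_A\to A\to N_A\to\Sigma P_A$ with $P_A\in\langle E\mathcal S\rangle$ and $N_A\in\mathcal N_{\mathcal I}$. -/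

import Mathlib

open CategoryTheory CategoryTheory.Limits CategoryTheory.Pretriangulated

namespace HomologicalIdeal

section Ideals

variable {T : Type*} [Category* T] [Preadditive T] {S : Type*} [Category* S] [Preadditive S]

/-- The kernel of a functor `F` on morphisms: `f` belongs to it iff `F f = 0`. -/
def kerIdeal (F : T ⥤ S) : MorphismProperty T := fun _ _ f => F.map f = 0

/-- `P` is projective for a class `I` of morphisms if `I(P, A) = 0` for all objects `A`. -/
def IsProjective (I : MorphismProperty T) (P : T) : Prop :=
  ∀ ⦃A : T⦄ (f : P ⟶ A), I f → f = 0

/-- The `I`-contractible objects: those `N` whose identity belongs to `I`. -/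
def contractibleObjects (I : MorphismProperty T) : ObjectProperty T := fun N => I (𝟙 N)

/-- For `I = ker F`, the chain complex `P` together with `δ₀ : P₀ ⟶ A` is an `I`-projective
resolution of `A`: each `P_n` is `I`-projective, `… ⟶ P₁ ⟶ P₀ ⟶ A` is a complex, and
its image `… ⟶ F P₁ ⟶ F P₀ ⟶ F A ⟶ 0` is contractible by a chain homotopy. -/
def IsProjectiveResolution (F : T ⥤ S) [F.Additive] {A : T} (P : ChainComplex T ℕ)
    (δ₀ : P.X 0 ⟶ A) : Prop :=
  (∀ n, IsProjective (kerIdeal F) (P.X n)) ∧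
    ∃ w : P.d 1 0 ≫ δ₀ = 0,
      Nonempty (Homotopy
        (𝟙 ((F.mapHomologicalComplex (ComplexShape.down ℕ)).obj (P.augment δ₀ w))) 0)

end Ideals

section Bar

variable {T : Type*} [Category* T]

/-- The iterates `Lⁿ A` of a comonad `L`. -/
def barObj (L : Comonad T) (A : T) : ℕ → T
  | 0 => A
  | n + 1 => L.obj (barObj L A n)

/-- The counit `ε_{L^n A} : L^{n+1} A ⟶ L^n A`. -/
def barCounit (L : Comonad T) (A : T) (n : ℕ) : barObj L A (n + 1) ⟶ barObj L A n :=
  L.ε.app (barObj L A n)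

/-- `L` applied to a morphism `L^m A ⟶ L^n A`. -/
def barMap (L : Comonad T) (A : T) {m n : ℕ} (f : barObj L A m ⟶ barObj L A n) :
    barObj L A (m + 1) ⟶ barObj L A (n + 1) :=
  L.map f

lemma barMap_comp_barCounit (L : Comonad T) (A : T) {m n : ℕ}
    (f : barObj L A m ⟶ barObj L A n) :
    barMap L A f ≫ barCounit L A n = barCounit L A m ≫ f :=
  L.ε.naturality f

variable [Preadditive T]

/-- The face morphisms `L^i(ε_{L^{n-i} A}) : L^{n+1} A ⟶ L^n A`, for `0 ≤ i ≤ n`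
(and `0` for `i > n`). -/
def barFace (L : Comonad T) (A : T) : (n i : ℕ) → (barObj L A (n + 1) ⟶ barObj L A n)
  | n, 0 => barCounit L A n
  | n + 1, i + 1 => barMap L A (barFace L A n i)
  | 0, _ + 1 => 0

/-- The alternating sum of the faces, `δ_n : L^{n+1} A ⟶ L^n A`. -/
def barDiff (L : Comonad T) (A : T) (n : ℕ) : barObj L A (n + 1) ⟶ barObj L A n :=
  ∑ i ∈ Finset.range (n + 1), (-1 : ℤ) ^ i • barFace L A n i

lemma barDiff_zero (L : Comonad T) (A : T) : barDiff L A 0 = barCounit L A 0 := by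
  simp [barDiff, barFace]

lemma barDiff_succ (L : Comonad T) [L.toFunctor.Additive] (A : T) (n : ℕ) :
    barDiff L A (n + 1) = barCounit L A (n + 1) - barMap L A (barDiff L A n) := by
  have h : barMap L A (barDiff L A n) =
      ∑ i ∈ Finset.range (n + 1), (-1 : ℤ) ^ i • barMap L A (barFace L A n i) := by
    rw [barDiff, barMap, Functor.map_sum]
    exact Finset.sum_congr rfl fun i _ => Functor.map_zsmul _
  rw [h, barDiff, Finset.sum_range_succ', sub_eq_add_neg, ← Finset.sum_neg_distrib]
  refine (add_comm _ _).trans ?_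
  congr 1
  · simp [barFace]
  · refine Finset.sum_congr rfl fun i _ => ?_
    rw [pow_succ, mul_neg_one, neg_smul]
    rfl

lemma barDiff_comp (L : Comonad T) [L.toFunctor.Additive] (A : T) (n : ℕ) :
    barDiff L A (n + 1) ≫ barDiff L A n = 0 := by
  induction n with
  | zero =>
    rw [barDiff_succ, barDiff_zero, Preadditive.sub_comp, barMap_comp_barCounit, sub_self]
  | succ n ih =>
    have h : barMap L A (barDiff L A (n + 1)) ≫ barMap L A (barDiff L A n) = 0 := by
      refine (L.map_comp _ _).symm.trans ?_
      rw [ih]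
      exact L.map_zero _ _
    rw [barDiff_succ L A (n + 1), Preadditive.sub_comp]
    nth_rewrite 3 [barDiff_succ L A n]
    rw [Preadditive.comp_sub, h, sub_zero, barMap_comp_barCounit, sub_self]

/-- The (unaugmented) bar complex `… ⟶ L³ A ⟶ L² A ⟶ L A`: in degree `n` it is
`P_n = L^{n+1} A`. Its augmentation is the counit `ε_A : L A ⟶ A`. -/
def barComplex (L : Comonad T) [L.toFunctor.Additive] (A : T) : ChainComplex T ℕ :=
  ChainComplex.of (fun n => barObj L A (n + 1)) (fun n => barDiff L A (n + 1))
    (fun n => barDiff_comp L A (n + 1))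

end Bar

instance toComonad_additive {T : Type*} [Category* T] [Preadditive T] {S : Type*} [Category* S]
    [Preadditive S] {E : S ⥤ T} {F : T ⥤ S} [E.Additive] [F.Additive] (adj : E ⊣ F) :
    adj.toComonad.toFunctor.Additive :=
  inferInstanceAs (F ⋙ E).Additive

section Triangulated

variable {T : Type*} [Category* T] [Preadditive T] [HasZeroObject T] [HasShift T ℤ]
  [∀ n : ℤ, (shiftFunctor T n).Additive] [Pretriangulated T]

/-- Localizing subcategories: (strictly full) triangulated subcategories closed under countable
direct sums. -/
structure IsLocalizing (P : ObjectProperty T) : Prop where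
  isTriangulated : P.IsTriangulated
  iso_closed : P.IsClosedUnderIsomorphisms
  sum_closed : P.IsClosedUnderColimitsOfShape (Discrete ℕ)

/-- The smallest localizing subcategory containing the objects in `P`. -/
def localizingClosure (P : ObjectProperty T) : ObjectProperty T :=
  fun X => ∀ Q : ObjectProperty T, IsLocalizing Q → P ≤ Q → Q X

/-- Complementary pairs of thick triangulated subcategories. -/
structure IsComplementary (L N : ObjectProperty T) : Prop where
  left_triangulated : L.IsTriangulated
  left_thick : L.IsStableUnderRetracts
  right_triangulated : N.IsTriangulated
  right_thick : N.IsStableUnderRetracts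
  hom_eq_zero : ∀ ⦃P M : T⦄, L P → N M → ∀ f : P ⟶ M, f = 0
  exists_triangle : ∀ A : T, ∃ (P M : T) (_ : L P) (_ : N M)
    (f : P ⟶ A) (g : A ⟶ M) (h : M ⟶ P⟦(1 : ℤ)⟧), Triangle.mk f g h ∈ distTriang T

end Triangulated

end HomologicalIdeal

/-!
Applying `F` to the augmented bar complex makes it contractible: the units `F Lⁿ A ⟶ F Lⁿ⁺¹ A` split
the counits, and naturality turns the recursion `δ_{n+1} = ε - L δ_n` into the homotopy identity.

For the complementary pair, an object `A` is approximated by cells, as in the construction of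
CW-approximations. Start with `Y₀ = E F A ⟶ A`, which becomes a split epimorphism under `F`. Given
`Y_n ⟶ A` with fibre `K_n`, let `Y_{n+1}` be the cone of `E F K_n ⟶ K_n ⟶ Y_n`; passing to it kills
the kernel of `F Y_n ⟶ F A`. So `F Y_n ⟶ F Y_{n+1}` factors through `F A`, whence `id - shift` on
`⨁ F Y_n` is a split monomorphism with complement `F A`. As `F` preserves the cone of `id - shift`,
the homotopy colimit of the `Y_n` maps to `A` by a morphism that `F` turns into an isomorphism, and
the cone of this morphism lies in the kernel of `F`.
-/

namespace HomologicalIdeal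

section Contraction

variable {C : Type*} [Category* C] [Preadditive C]

/-- The null homotopy of the identity of a chain complex given by a contraction `s`. -/
noncomputable def homotopyOfContraction (K : ChainComplex C ℕ) (s : ∀ n, K.X n ⟶ K.X (n + 1))
    (s_zero : s 0 ≫ K.d 1 0 = 𝟙 _)
    (s_succ : ∀ n, K.d (n + 1) n ≫ s n + s (n + 1) ≫ K.d (n + 2) (n + 1) = 𝟙 _) :
    Homotopy (𝟙 K) 0 :=
  let h : ∀ i j, (ComplexShape.down ℕ).Rel j i → (K.X i ⟶ K.X j) :=
    fun i _ hij => s i ≫ eqToHom (congrArg K.X hij)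
  have id_eq : 𝟙 K = Homotopy.nullHomotopicMap' h := by
    ext (_ | n)
    · rw [Homotopy.nullHomotopicMap'_f_of_not_rel_left (k₁ := 1) rfl (by simp) h]
      simp [h, s_zero]
    · rw [Homotopy.nullHomotopicMap'_f (k₂ := n + 2) (k₁ := n + 1) (k₀ := n) rfl rfl h]
      simp [h, s_succ]
  (Homotopy.ofEq id_eq).trans (Homotopy.nullHomotopy' h)

end Contraction

section Bar

lemma barComplex_d {T : Type*} [Category* T] [Preadditive T] (L : Comonad T)
    [L.toFunctor.Additive] (A : T) (n : ℕ) :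
    (barComplex L A).d (n + 1) n = barDiff L A (n + 1) :=
  ChainComplex.of_d (fun n => barObj L A (n + 1)) (fun n => barDiff L A (n + 1)) n

lemma barComplex_d_comp_counit {T : Type*} [Category* T] [Preadditive T] (L : Comonad T)
    [L.toFunctor.Additive] (A : T) : (barComplex L A).d 1 0 ≫ L.ε.app A = 0 := by
  have d_comp_d := barDiff_comp L A 0
  rw [barDiff_zero] at d_comp_d
  rw [barComplex_d]
  exact d_comp_d

variable {S : Type*} [Category* S] {T : Type*} [Category* T] {E : S ⥤ T} {F : T ⥤ S}
  (adj : E ⊣ F)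

/-- The unit `F Lⁿ A ⟶ F Lⁿ⁺¹ A` of the adjunction, which contracts the image under `F` of the
augmented bar complex. -/
def barUnit (A : T) (n : ℕ) :
    F.obj (barObj adj.toComonad A n) ⟶ F.obj (barObj adj.toComonad A (n + 1)) :=
  adj.unit.app (F.obj (barObj adj.toComonad A n))

lemma barUnit_comp_map_barCounit (A : T) (n : ℕ) :
    barUnit adj A n ≫ F.map (barCounit adj.toComonad A n) = 𝟙 _ :=
  adj.right_triangle_components _

lemma barUnit_comp_map_barMap (A : T) {m n : ℕ}
    (f : barObj adj.toComonad A m ⟶ barObj adj.toComonad A n) :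
    barUnit adj A m ≫ F.map (barMap adj.toComonad A f) = F.map f ≫ barUnit adj A n :=
  (adj.unit.naturality (F.map f)).symm

variable [Preadditive S] [Preadditive T] [F.Additive]

lemma isProjective_obj (adj : E ⊣ F) (X : S) : IsProjective (kerIdeal F) (E.obj X) := by
  intro A f (hf : F.map f = 0)
  apply (adj.homEquiv X A).injective
  simp only [Adjunction.homEquiv_unit, hf, F.map_zero]

variable [E.Additive]

lemma map_barDiff_comp_barUnit_add (A : T) (n : ℕ) :
    F.map (barDiff adj.toComonad A n) ≫ barUnit adj A n +
      barUnit adj A (n + 1) ≫ F.map (barDiff adj.toComonad A (n + 1)) = 𝟙 _ := by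
  rw [barDiff_succ, F.map_sub, Preadditive.comp_sub, barUnit_comp_map_barCounit,
    barUnit_comp_map_barMap, add_sub_cancel]

lemma isProjectiveResolution_barComplex (A : T) :
    IsProjectiveResolution F (A := A) (barComplex adj.toComonad A) (adj.counit.app A) := by
  refine ⟨fun n => isProjective_obj adj _, barComplex_d_comp_counit adj.toComonad A, ⟨?_⟩⟩
  refine homotopyOfContraction _ (fun | 0 => barUnit adj A 0 | n + 1 => barUnit adj A (n + 1))
    (barUnit_comp_map_barCounit adj A 0) ?_
  rintro (_ | n)
  · have contraction := map_barDiff_comp_barUnit_add adj A 0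
    rw [barDiff_zero, ← barComplex_d] at contraction
    exact contraction
  · have contraction := map_barDiff_comp_barUnit_add adj A (n + 1)
    rw [← barComplex_d, ← barComplex_d] at contraction
    exact contraction

end Bar

section Telescope

lemma map_cofanDesc {C D J : Type*} [Category* C] [Category* D] (F : C ⥤ D) {X : J → C}
    [HasCoproduct X] [PreservesColimit (Discrete.functor X) F] {A : C} (f : ∀ j, X j ⟶ A) :
    F.map (Cofan.IsColimit.desc (coproductIsCoproduct X) f) =
      Cofan.IsColimit.desc (isColimitOfHasCoproductOfPreservesColimit F X) fun j => F.map (f j) :=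
  Cofan.IsColimit.hom_ext (isColimitOfHasCoproductOfPreservesColimit F X) _ _ fun j => by
    rw [Cofan.IsColimit.fac]
    exact (F.map_comp _ _).symm.trans
      (congrArg F.map (Cofan.IsColimit.fac (coproductIsCoproduct X) f j))

variable {C : Type*} [Category* C] [Preadditive C] {X : ℕ → C} (i : ∀ n, X n ⟶ X (n + 1))
  {c : Cofan X} (hc : IsColimit c)

/-- The morphism `id - shift` on the direct sum of a sequence of objects; its cone is the homotopy
colimit of the sequence. -/
def telescopeMap : c.pt ⟶ c.pt :=
  Cofan.IsColimit.desc hc fun n => c.inj n - i n ≫ c.inj (n + 1)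

@[simp]
lemma inj_telescopeMap (n : ℕ) :
    c.inj n ≫ telescopeMap i hc = c.inj n - i n ≫ c.inj (n + 1) :=
  Cofan.IsColimit.fac hc _ n

lemma inj_telescopeMap_comp (n : ℕ) {Y : C} (g : c.pt ⟶ Y) :
    c.inj n ≫ telescopeMap i hc ≫ g = c.inj n ≫ g - i n ≫ c.inj (n + 1) ≫ g := by
  rw [← Category.assoc, inj_telescopeMap, Preadditive.sub_comp, Category.assoc]

lemma telescopeMap_comp_desc {A : C} (f : ∀ n, X n ⟶ A) (hf : ∀ n, i n ≫ f (n + 1) = f n) :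
    telescopeMap i hc ≫ Cofan.IsColimit.desc hc f = 0 :=
  Cofan.IsColimit.hom_ext hc _ _ fun n => by
    rw [inj_telescopeMap_comp, Cofan.IsColimit.fac, Cofan.IsColimit.fac, hf, sub_self, comp_zero]

lemma map_telescopeMap {D : Type*} [Category* D] [Preadditive D] (F : C ⥤ D) [F.Additive]
    [HasCoproduct X] [PreservesColimit (Discrete.functor X) F] :
    F.map (telescopeMap i (coproductIsCoproduct X)) =
      telescopeMap (fun n => F.map (i n)) (isColimitOfHasCoproductOfPreservesColimit F X) := by
  refine (map_cofanDesc F _).trans ?_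
  simp only [F.map_sub, F.map_comp]
  rfl

variable {A : C} (f : ∀ n, X n ⟶ A) (s : ∀ n, A ⟶ X n)

/-- A retraction of `id - shift` for a sequence whose transition maps factor as
`f n ≫ s (n + 1)` through split epimorphisms `f n` with sections `s n`. -/
def telescopeRetraction : c.pt ⟶ c.pt :=
  Cofan.IsColimit.desc hc fun n => c.inj n - f n ≫ ∑ k ∈ Finset.range (n + 1), s k ≫ c.inj k

@[simp]
lemma inj_telescopeRetraction (n : ℕ) :
    c.inj n ≫ telescopeRetraction hc f s =
      c.inj n - f n ≫ ∑ k ∈ Finset.range (n + 1), s k ≫ c.inj k :=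
  Cofan.IsColimit.fac hc _ n

variable {i f s}

lemma telescopeMap_comp_retraction (s_comp_f : ∀ n, s n ≫ f n = 𝟙 A)
    (i_eq : ∀ n, i n = f n ≫ s (n + 1)) :
    telescopeMap i hc ≫ telescopeRetraction hc f s = 𝟙 _ := by
  refine Cofan.IsColimit.hom_ext hc _ _ fun n => ?_
  have cancel : s (n + 1) ≫ f (n + 1) ≫ ∑ k ∈ Finset.range (n + 2), s k ≫ c.inj k =
      ∑ k ∈ Finset.range (n + 1), s k ≫ c.inj k + s (n + 1) ≫ c.inj (n + 1) := by
    rw [← Category.assoc, s_comp_f, Category.id_comp, Finset.sum_range_succ]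
  rw [inj_telescopeMap_comp, inj_telescopeRetraction, inj_telescopeRetraction, i_eq,
    Category.assoc, Preadditive.comp_sub, cancel, Preadditive.comp_sub, Preadditive.comp_add,
    Category.comp_id]
  abel

lemma retraction_comp_telescopeMap (s_comp_f : ∀ n, s n ≫ f n = 𝟙 A)
    (i_eq : ∀ n, i n = f n ≫ s (n + 1)) :
    telescopeRetraction hc f s ≫ telescopeMap i hc =
      𝟙 _ - Cofan.IsColimit.desc hc f ≫ s 0 ≫ c.inj 0 := by
  refine Cofan.IsColimit.hom_ext hc _ _ fun n => ?_
  have s_comp_i (k : ℕ) : s k ≫ i k = s (k + 1) := by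
    rw [i_eq, ← Category.assoc, s_comp_f, Category.id_comp]
  have telescoping : ∑ k ∈ Finset.range (n + 1), s k ≫ c.inj k ≫ telescopeMap i hc =
      s 0 ≫ c.inj 0 - s (n + 1) ≫ c.inj (n + 1) := by
    simp only [inj_telescopeMap, Preadditive.comp_sub, ← Category.assoc, s_comp_i]
    exact Finset.sum_range_sub' (fun k => s k ≫ c.inj k) (n + 1)
  rw [← Category.assoc, inj_telescopeRetraction, Preadditive.sub_comp, Category.assoc,
    Preadditive.sum_comp]
  simp only [Category.assoc]
  rw [telescoping, inj_telescopeMap, i_eq, Preadditive.comp_sub, Preadditive.comp_sub,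
    Category.comp_id, ← Category.assoc (c.inj n), Cofan.IsColimit.fac, Category.assoc]
  abel

lemma isIso_of_distinguished_telescopeMap [HasZeroObject C] [HasShift C ℤ]
    [∀ n : ℤ, (shiftFunctor C n).Additive] [Pretriangulated C]
    (s_comp_f : ∀ n, s n ≫ f n = 𝟙 A) (i_eq : ∀ n, i n = f n ≫ s (n + 1))
    {Z : C} {v : c.pt ⟶ Z} {w : Z ⟶ c.pt⟦(1 : ℤ)⟧}
    (hT : Triangle.mk (telescopeMap i hc) v w ∈ distTriang C)
    {g : Z ⟶ A} (hg : v ≫ g = Cofan.IsColimit.desc hc f) : IsIso g := by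
  have : Mono (telescopeMap i hc) :=
    mono_of_mono_fac (telescopeMap_comp_retraction hc s_comp_f i_eq)
  have : Epi v := Triangle.epi₂ _ hT (Triangle.mor₃_eq_zero_of_mono₁ _ hT this)
  have desc_comp : Cofan.IsColimit.desc hc f ≫ s 0 ≫ c.inj 0 ≫ v = v := by
    have h := congrArg (· ≫ v) (retraction_comp_telescopeMap hc s_comp_f i_eq)
    have hv : telescopeMap i hc ≫ v = 0 := comp_distTriang_mor_zero₁₂ _ hT
    simp only [Category.assoc, hv, comp_zero, Preadditive.sub_comp, Category.id_comp] at h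
    exact (sub_eq_zero.1 h.symm).symm
  refine ⟨s 0 ≫ c.inj 0 ≫ v, ?_, ?_⟩
  · rw [← cancel_epi v, ← Category.assoc, hg, desc_comp, Category.comp_id]
  · rw [Category.assoc, Category.assoc, hg, Cofan.IsColimit.fac, s_comp_f]

end Telescope

section Localizing

variable {T : Type*} [Category* T] [Preadditive T] [HasZeroObject T] [HasShift T ℤ]
  [∀ n : ℤ, (shiftFunctor T n).Additive] [Pretriangulated T]

lemma le_localizingClosure (P : ObjectProperty T) : P ≤ localizingClosure P :=
  fun _ hX _ _ hPQ => hPQ _ hX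

lemma localizingClosure_le {P Q : ObjectProperty T} (hQ : IsLocalizing Q) (hPQ : P ≤ Q) :
    localizingClosure P ≤ Q :=
  fun _ hX => hX Q hQ hPQ

lemma isLocalizing_localizingClosure (P : ObjectProperty T) :
    IsLocalizing (localizingClosure P) where
  isTriangulated :=
    { exists_zero := ⟨_, isZero_zero T, fun Q hQ _ =>
        have := hQ.isTriangulated
        have := hQ.iso_closed
        Q.prop_zero⟩
      isStableUnderShiftBy n := ⟨fun _ hX Q hQ hPQ =>
        have := hQ.isTriangulated
        Q.le_shift n _ (hX Q hQ hPQ)⟩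
      ext₂' t ht h₁ h₃ := ObjectProperty.le_isoClosure _ _ fun Q hQ hPQ =>
        have := hQ.isTriangulated
        have := hQ.iso_closed
        Q.ext_of_isTriangulatedClosed₂ t ht (h₁ Q hQ hPQ) (h₃ Q hQ hPQ) }
  iso_closed := ⟨fun e hX Q hQ hPQ =>
    have := hQ.iso_closed
    Q.prop_of_iso e (hX Q hQ hPQ)⟩
  sum_closed := ⟨fun _ ⟨p⟩ Q hQ hPQ =>
    have := hQ.sum_closed
    Q.prop_of_isColimit p.isColimit fun j => p.prop_diag_obj j Q hQ hPQ⟩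

lemma isLocalizing_leftOrthogonal (N : ObjectProperty T) [N.IsStableUnderShift ℤ] :
    IsLocalizing N.leftOrthogonal where
  isTriangulated := inferInstance
  iso_closed := inferInstance
  sum_closed := ⟨fun _ ⟨p⟩ _ f hY => p.isColimit.hom_ext fun j => by
    rw [comp_zero]
    exact p.prop_diag_obj j _ hY⟩

end Localizing

section Complementary

lemma isStableUnderRetracts_leftOrthogonal {C : Type*} [Category* C] [HasZeroMorphisms C]
    (N : ObjectProperty C) : N.leftOrthogonal.IsStableUnderRetracts where
  of_retract r hY _ f hM := by
    rw [← Category.id_comp f, ← r.retract, Category.assoc, hY (r.r ≫ f) hM, comp_zero]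

variable {T : Type*} [Category* T] [Preadditive T] [HasZeroObject T] [HasShift T ℤ]
  [∀ n : ℤ, (shiftFunctor T n).Additive] [Pretriangulated T]

lemma eq_leftOrthogonal_of_exists_triangle {L N : ObjectProperty T} [N.IsStableUnderShift ℤ]
    [L.IsClosedUnderIsomorphisms] (hLN : L ≤ N.leftOrthogonal)
    (exists_triangle : ∀ A : T, ∃ (P M : T) (_ : L P) (_ : N M)
      (f : P ⟶ A) (g : A ⟶ M) (h : M ⟶ P⟦(1 : ℤ)⟧), Triangle.mk f g h ∈ distTriang T) :
    L = N.leftOrthogonal := by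
  refine le_antisymm hLN fun A hA => ?_
  obtain ⟨P, M, hP, hM, f, g, h, hT⟩ := exists_triangle A
  have M_orthogonal : N.leftOrthogonal M :=
    N.leftOrthogonal.ext_of_isTriangulatedClosed₃ _ hT (hLN _ hP) hA
  have M_isZero : IsZero M := (IsZero.iff_id_eq_zero M).2 (M_orthogonal (𝟙 M) hM)
  have : IsIso f := (Triangle.isZero₃_iff_isIso₁ _ hT).1 M_isZero
  exact L.prop_of_iso (asIso f) hP

lemma isComplementary_of_exists_triangle {L N : ObjectProperty T} [L.IsTriangulated]
    [L.IsClosedUnderIsomorphisms] [N.IsTriangulated] [N.IsStableUnderRetracts]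
    (hLN : L ≤ N.leftOrthogonal)
    (exists_triangle : ∀ A : T, ∃ (P M : T) (_ : L P) (_ : N M)
      (f : P ⟶ A) (g : A ⟶ M) (h : M ⟶ P⟦(1 : ℤ)⟧), Triangle.mk f g h ∈ distTriang T) :
    IsComplementary L N where
  left_triangulated := inferInstance
  left_thick := by
    rw [eq_leftOrthogonal_of_exists_triangle hLN exists_triangle]
    exact isStableUnderRetracts_leftOrthogonal N
  right_triangulated := inferInstance
  right_thick := inferInstance
  hom_eq_zero _ _ hP hM f := hLN _ hP f hM
  exists_triangle := exists_triangle

end Complementary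

section Kernel

lemma contractibleObjects_kerIdeal_eq_kernel {S : Type*} [Category* S] [Preadditive S]
    {T : Type*} [Category* T] (F : T ⥤ S) : contractibleObjects (kerIdeal F) = F.kernel := by
  ext N
  change F.map (𝟙 N) = 0 ↔ IsZero (F.obj N)
  rw [F.map_id, IsZero.iff_id_eq_zero]

lemma isStableUnderRetracts_kernel {S : Type*} [Category* S] [HasZeroMorphisms S]
    {T : Type*} [Category* T] (F : T ⥤ S) : F.kernel.IsStableUnderRetracts where
  of_retract r h := IsZero.of_mono (F.map r.i) h

variable {S : Type*} [Category* S] [Preadditive S] [HasZeroObject S] [HasShift S ℤ]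
  [∀ n : ℤ, (shiftFunctor S n).Additive] [Pretriangulated S]

lemma isTriangulated_isZero : ObjectProperty.IsTriangulated (IsZero : ObjectProperty S) where
  exists_zero := ⟨_, isZero_zero S, isZero_zero S⟩
  isStableUnderShiftBy n := ⟨fun _ h => (shiftFunctor S n).map_isZero h⟩
  toIsTriangulatedClosed₂ := .mk' Triangle.isZero₂_of_isZero₁₃

variable {T : Type*} [Category* T] [Preadditive T] [HasZeroObject T] [HasShift T ℤ]
  [∀ n : ℤ, (shiftFunctor T n).Additive] [Pretriangulated T]

lemma isTriangulated_kernel (F : T ⥤ S) [F.CommShift ℤ] [F.IsTriangulated] :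
    F.kernel.IsTriangulated :=
  have := isTriangulated_isZero (S := S)
  inferInstance

end Kernel

section Approximation

variable {S : Type*} [Category* S] [Preadditive S] [HasZeroObject S] [HasShift S ℤ]
  [∀ n : ℤ, (shiftFunctor S n).Additive] [Pretriangulated S]
  {T : Type*} [Category* T] [Preadditive T] [HasZeroObject T] [HasShift T ℤ]
  [∀ n : ℤ, (shiftFunctor T n).Additive] [Pretriangulated T]
  {E : S ⥤ T} {F : T ⥤ S} [F.CommShift ℤ] [F.IsTriangulated]
  {L : ObjectProperty T} [L.IsTriangulated] [L.IsClosedUnderIsomorphisms]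

lemma exists_over_hom_killing_kernel (adj : E ⊣ F) (hEL : ObjectProperty.ofObj E.obj ≤ L)
    {A : T} (Y : Over A) :
    ∃ (Y' : Over A) (i : Y ⟶ Y'), (L Y.left → L Y'.left) ∧
      ∀ ⦃X : S⦄ (k : X ⟶ F.obj Y.left), k ≫ F.map Y.hom = 0 → k ≫ F.map i.left = 0 := by
  obtain ⟨K, ι, _, fibre⟩ := distinguished_cocone_triangle₁ Y.hom
  obtain ⟨Z, i, _, cone⟩ := distinguished_cocone_triangle (adj.counit.app K ≫ ι)
  have ι_comp : ι ≫ Y.hom = 0 := comp_distTriang_mor_zero₁₂ _ fibre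
  obtain ⟨f, hf : Y.hom = i ≫ f⟩ := Triangle.yoneda_exact₂ _ cone Y.hom
    (show (adj.counit.app K ≫ ι) ≫ Y.hom = 0 by rw [Category.assoc, ι_comp, comp_zero])
  refine ⟨Over.mk f, Over.homMk i hf.symm,
    L.ext_of_isTriangulatedClosed₃ _ cone (hEL _ ⟨F.obj K⟩), fun X k hk => ?_⟩
  obtain ⟨m : X ⟶ F.obj K, hm : k = m ≫ F.map ι⟩ :=
    Triangle.coyoneda_exact₂ _ (F.map_distinguished _ fibre) k hk
  have comp_i : adj.counit.app K ≫ ι ≫ i = 0 := by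
    rw [← Category.assoc]
    exact comp_distTriang_mor_zero₁₂ _ cone
  -- `F` turns the counit into a split epimorphism, so `F (ι ≫ i)` vanishes.
  have map_comp_i : F.map (ι ≫ i) = 0 := by
    rw [← Category.id_comp (F.map _), ← adj.right_triangle_components, Category.assoc,
      ← F.map_comp, comp_i, F.map_zero, comp_zero]
  change k ≫ F.map i = 0
  rw [hm, Category.assoc, ← F.map_comp, map_comp_i, comp_zero]

lemma exists_over_sequence (adj : E ⊣ F) (hEL : ObjectProperty.ofObj E.obj ≤ L) (A : T) :
    ∃ (Y : ℕ → Over A) (i : ∀ n, Y n ⟶ Y (n + 1)) (s : ∀ n, F.obj A ⟶ F.obj (Y n).left),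
      (∀ n, L (Y n).left) ∧
      (∀ n, s n ≫ F.map (Y n).hom = 𝟙 _) ∧
      ∀ n, F.map (i n).left = F.map (Y n).hom ≫ s (n + 1) := by
  choose next i hnext killed using exists_over_hom_killing_kernel adj hEL (A := A)
  let Y (n : ℕ) : Over A := n.rec (Over.mk (adj.counit.app A)) fun _ => next
  let s (n : ℕ) : F.obj A ⟶ F.obj (Y n).left :=
    n.rec (adj.unit.app (F.obj A)) fun n s => s ≫ F.map (i (Y n)).left
  have hY (n : ℕ) : L (Y n).left :=
    n.rec (hEL _ ⟨F.obj A⟩) fun n => hnext (Y n)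
  have s_comp (n : ℕ) : s n ≫ F.map (Y n).hom = 𝟙 _ := by
    induction n with
    | zero => exact adj.right_triangle_components A
    | succ n ih =>
      change (s n ≫ F.map (i (Y n)).left) ≫ F.map (next (Y n)).hom = 𝟙 _
      rw [Category.assoc, ← F.map_comp, Over.w, ih]
  refine ⟨Y, fun n => i (Y n), s, hY, s_comp, fun n => ?_⟩
  have kernel_part_killed :
      (𝟙 _ - F.map (Y n).hom ≫ s n) ≫ F.map (i (Y n)).left = 0 :=
    killed (Y n) _ (by
      rw [Preadditive.sub_comp, Category.id_comp, Category.assoc, s_comp, Category.comp_id,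
        sub_self])
  rw [Preadditive.sub_comp, Category.id_comp, Category.assoc] at kernel_part_killed
  exact sub_eq_zero.1 kernel_part_killed

variable [HasCoproductsOfShape ℕ T] [PreservesColimitsOfShape (Discrete ℕ) F]

lemma exists_hom_isIso_map [L.IsClosedUnderColimitsOfShape (Discrete ℕ)] (adj : E ⊣ F)
    (hEL : ObjectProperty.ofObj E.obj ≤ L) (A : T) :
    ∃ (P : T) (p : P ⟶ A), L P ∧ IsIso (F.map p) := by
  obtain ⟨Y, i, s, hY, s_comp, map_i⟩ := exists_over_sequence adj hEL A
  let X (n : ℕ) : T := (Y n).left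
  let hX : IsColimit _ := coproductIsCoproduct X
  obtain ⟨P, v, w, hT⟩ := distinguished_cocone_triangle (telescopeMap (fun n => (i n).left) hX)
  obtain ⟨p : P ⟶ A, hp : _ = v ≫ p⟩ := Triangle.yoneda_exact₂ _ hT
    (Cofan.IsColimit.desc hX fun n => (Y n).hom)
    (telescopeMap_comp_desc _ hX _ fun n => Over.w (i n))
  have coproduct_mem : L (∐ X) := L.prop_colimit _ fun n => hY n.as
  refine ⟨P, p, L.ext_of_isTriangulatedClosed₃ _ hT coproduct_mem coproduct_mem, ?_⟩
  have map_hT : Triangle.mk (telescopeMap (fun n => F.map (i n).left)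
      (isColimitOfHasCoproductOfPreservesColimit F X)) (F.map v)
      (F.map w ≫ (F.commShiftIso (1 : ℤ)).hom.app _) ∈ distTriang S := by
    rw [← map_telescopeMap]
    exact F.map_distinguished _ hT
  refine isIso_of_distinguished_telescopeMap _ s_comp map_i map_hT ?_
  rw [← F.map_comp, ← hp]
  exact map_cofanDesc F _

lemma isComplementary_localizingClosure_kernel (adj : E ⊣ F) :
    IsComplementary (localizingClosure (ObjectProperty.ofObj E.obj)) F.kernel := by
  have hL := isLocalizing_localizingClosure (ObjectProperty.ofObj E.obj)
  have := hL.isTriangulated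
  have := hL.iso_closed
  have := hL.sum_closed
  have := isTriangulated_kernel F
  have := isStableUnderRetracts_kernel F
  refine isComplementary_of_exists_triangle ?_ fun A => ?_
  · refine localizingClosure_le (isLocalizing_leftOrthogonal _) ?_
    rintro _ ⟨X⟩ M f hM
    exact (adj.homEquiv X M).injective (IsZero.eq_of_tgt hM _ _)
  · obtain ⟨P, p, hP, map_p_isIso⟩ := exists_hom_isIso_map adj (le_localizingClosure _) A
    obtain ⟨M, g, h, hT⟩ := distinguished_cocone_triangle p
    have M_mem_kernel : F.kernel M :=
      (Triangle.isZero₃_iff_isIso₁ _ (F.map_distinguished _ hT)).2 map_p_isIso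
    exact ⟨P, M, hP, M_mem_kernel, p, g, h, hT⟩

end Approximation

end HomologicalIdeal

theorem proposition2p1_general
    {S : Type*} [Category* S] [Preadditive S] [HasZeroObject S] [HasShift S ℤ]
    [∀ n : ℤ, (shiftFunctor S n).Additive] [Pretriangulated S]
    {T : Type*} [Category* T] [Preadditive T] [HasZeroObject T] [HasShift T ℤ]
    [∀ n : ℤ, (shiftFunctor T n).Additive] [Pretriangulated T] [HasCoproductsOfShape ℕ T]
    (E : S ⥤ T) [E.Additive]
    (F : T ⥤ S) [F.CommShift ℤ] [F.IsTriangulated] [PreservesColimitsOfShape (Discrete ℕ) F]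
    (adj : E ⊣ F) :
    (∀ A : T, HomologicalIdeal.IsProjectiveResolution F (A := A)
      (HomologicalIdeal.barComplex adj.toComonad A) (adj.counit.app A)) ∧
    HomologicalIdeal.IsComplementary
      (HomologicalIdeal.localizingClosure (ObjectProperty.ofObj E.obj))
      (HomologicalIdeal.contractibleObjects (HomologicalIdeal.kerIdeal F)) := by
  refine ⟨HomologicalIdeal.isProjectiveResolution_barComplex adj, ?_⟩
  rw [HomologicalIdeal.contractibleObjects_kerIdeal_eq_kernel]
  exact HomologicalIdeal.isComplementary_localizingClosure_kernel adj

theorem proposition2p1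
    {S : Type*} [Category* S] [Preadditive S] [HasZeroObject S] [HasShift S ℤ]
    [∀ n : ℤ, (shiftFunctor S n).Additive] [Pretriangulated S] [IsTriangulated S]
    [HasCoproductsOfShape ℕ S]
    {T : Type*} [Category* T] [Preadditive T] [HasZeroObject T] [HasShift T ℤ]
    [∀ n : ℤ, (shiftFunctor T n).Additive] [Pretriangulated T] [IsTriangulated T]
    [HasCoproductsOfShape ℕ T]
    (E : S ⥤ T) [E.CommShift ℤ] [E.IsTriangulated] [PreservesColimitsOfShape (Discrete ℕ) E]
    (F : T ⥤ S) [F.CommShift ℤ] [F.IsTriangulated] [PreservesColimitsOfShape (Discrete ℕ) F]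
    (adj : E ⊣ F) :
    (∀ A : T, HomologicalIdeal.IsProjectiveResolution F (A := A)
      (HomologicalIdeal.barComplex adj.toComonad A) (adj.counit.app A)) ∧
    HomologicalIdeal.IsComplementary
      (HomologicalIdeal.localizingClosure (ObjectProperty.ofObj E.obj))
      (HomologicalIdeal.contractibleObjects (HomologicalIdeal.kerIdeal F)) :=
  proposition2p1_general E F adj
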